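/- A digraph is a finite set of vertices with a binary relation (its arcs) without loops; its order is its number of vertices. A homomorphism of digraphs is a map of vertices that sends arcs to arcs, and two digraphs are homomorphically equivalent if there are homomorphisms between them in both directions. The core of a digraph $G$ is the digraph of smallest order that is homomorphically equivalent to $G$ (it is unique up to isomorphism). The tensor product of a family $(D_i)_{i\in I}$ of digraphs has vertex set $\prod_{i\in I} V(D_i)$, with an arc from $(u_i)_i$ to $(v_i)_i$ exactly when there is an arc from $u_i$ to $v_i$ in $D_i$ for every $i\in I$. Proposition. There are a constant $c>0$ and an integer $n_0$ such that for every integer $n\ge n_0$ there is a finite nonempty family of digraphs, each of order at most $n$, whose tensor product has a core of order at least $$c\, n^{2^{\sqrt n}/\sqrt n}.$$ In other words, there are such families whose tensor product has a core of order $\Omega\left(n^{2^{\sqrt n}/\sqrt n}\right)$. -/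

import Mathlib

namespace Digraph

/-- `G → H`: there is a homomorphism, i.e. a map of vertices that sends arcs to arcs. -/
def HasHom {V W : Type} (G : Digraph V) (H : Digraph W) : Prop :=
  Nonempty (G.Adj →r H.Adj)

/-- Homomorphic equivalence: there are homomorphisms in both directions. -/
def HomEquiv {V W : Type} (G : Digraph V) (H : Digraph W) : Prop :=
  G.HasHom H ∧ H.HasHom G

/-- No vertex carries a loop. -/
def IsLoopless {V : Type} (G : Digraph V) : Prop :=
  ∀ v, ¬ G.Adj v v

/-- The tensor (categorical, direct) product of a family of digraphs: the vertices are the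
tuples of vertices, and there is an arc exactly when there is an arc in every coordinate. -/
def tensorProd {ι : Type} {V : ι → Type} (D : ∀ i, Digraph (V i)) : Digraph (∀ i, V i) where
  Adj u v := ∀ i, (D i).Adj (u i) (v i)

/-- `C` is the core of `G`: a finite digraph homomorphically equivalent to `G` with the smallest
number of vertices among all finite digraphs homomorphically equivalent to `G`.
(The core is unique up to isomorphism.) -/
def IsCoreOf {V W : Type} (C : Digraph W) (G : Digraph V) : Prop :=
  Finite W ∧ C.HomEquiv G ∧
    ∀ (U : Type) (_ : Finite U) (K : Digraph U), K.HomEquiv G → Nat.card W ≤ Nat.card U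

end Digraph

namespace Digraph

/-! Patterns are preserved by homomorphisms and, in a product, hold coordinatewise. In `avoid X` the
root `b` has pattern `A` exactly when `X b ⊄ A`. With the sets of all factors forming an antichain,
a tuple of roots `S` has pattern `X i b` iff `S i ≠ b`, and these patterns survive passage to any
equivalent digraph. So `2 ^ k` factors give a core of order at least `2 ^ 2 ^ k`, while factors of
order linear in `k` suffice; take `k = ⌈√n⌉`. -/

/-- The vertex `v` is the source of a directed walk `v → g → q 0 → q 1 → ⋯ → q M` such that there is
also an arc from `g` to `q (a + 1)` for every `a ∈ A`. -/
def HasPattern {V : Type} (G : Digraph V) {M : ℕ} (A : Finset (Fin M)) (v : V) : Prop :=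
  ∃ (g : V) (q : Fin (M + 1) → V), G.Adj v g ∧ G.Adj g (q 0) ∧
    (∀ j : Fin M, G.Adj (q j.castSucc) (q j.succ)) ∧ ∀ a ∈ A, G.Adj g (q a.succ)

theorem HasPattern.map {V W : Type} {G : Digraph V} {H : Digraph W} {M : ℕ} {A : Finset (Fin M)}
    {v : V} (h : G.HasPattern A v) (f : G.Adj →r H.Adj) : H.HasPattern A (f v) := by
  obtain ⟨g, q, h1, h2, h3, h4⟩ := h
  exact ⟨f g, fun j => f (q j), f.map_rel h1, f.map_rel h2, fun j => f.map_rel (h3 j),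
    fun a ha => f.map_rel (h4 a ha)⟩

theorem hasPattern_tensorProd {ι : Type} {V : ι → Type} {D : ∀ i, Digraph (V i)} {M : ℕ}
    {A : Finset (Fin M)} {v : ∀ i, V i} :
    (tensorProd D).HasPattern A v ↔ ∀ i, (D i).HasPattern A (v i) := by
  constructor
  · rintro ⟨g, q, h1, h2, h3, h4⟩ i
    exact ⟨g i, fun j => q j i, h1 i, h2 i, fun j => h3 j i, fun a ha => h4 a ha i⟩
  · intro h
    choose g q h1 h2 h3 h4 using h
    exact ⟨g, fun j i => q i j, h1, h2, fun j i => h3 i j, fun a ha i => h4 i a ha⟩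

/-- Vertices of the pattern-avoiding digraphs: two roots, `M` guesses and a chain of `M + 1`
positions. -/
abbrev AvoidVertex (M : ℕ) : Type := Bool ⊕ (Fin M ⊕ Fin (M + 1))

/-- The arcs of the digraph whose root `b` has precisely the patterns not containing `X b`. -/
def avoidAdj {M : ℕ} (X : Bool → Finset (Fin M)) : AvoidVertex M → AvoidVertex M → Prop
  | .inl b, .inr (.inl j) => j ∈ X b
  | .inr (.inl j), .inr (.inr p) => p ≠ j.succ
  | .inr (.inr p), .inr (.inr p') => p.val + 1 = p'.val
  | _, _ => False

/-- The digraph whose root `b` has precisely the patterns not containing `X b`. -/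
def avoid {M : ℕ} (X : Bool → Finset (Fin M)) : Digraph (AvoidVertex M) where
  Adj := avoidAdj X

/-- A height function increasing along the arcs of `avoid X`. -/
def avoidLevel {M : ℕ} : AvoidVertex M → ℕ
  | .inl _ => 0
  | .inr (.inl _) => 1
  | .inr (.inr p) => p.val + 2

@[simp] theorem avoidLevel_root {M : ℕ} (b : Bool) :
    avoidLevel (M := M) (.inl b) = 0 := rfl

@[simp] theorem avoidLevel_guess {M : ℕ} (j : Fin M) :
    avoidLevel (.inr (.inl j)) = 1 := rfl

@[simp] theorem avoidLevel_position {M : ℕ} (p : Fin (M + 1)) :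
    avoidLevel (.inr (.inr p)) = p.val + 2 := rfl

theorem avoidLevel_lt {M : ℕ} {X : Bool → Finset (Fin M)} {u v : AvoidVertex M}
    (h : (avoid X).Adj u v) : avoidLevel u < avoidLevel v := by
  rcases u with b | j | p <;> rcases v with b' | j' | p' <;>
    simp_all [avoid, avoidAdj]
  omega

theorem avoidLevel_le {M : ℕ} (v : AvoidVertex M) : avoidLevel v ≤ M + 2 := by
  rcases v with b | j | p <;> simp
  omega

theorem avoid_isLoopless {M : ℕ} (X : Bool → Finset (Fin M)) : (avoid X).IsLoopless :=
  fun _ h => lt_irrefl _ (avoidLevel_lt h)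

theorem card_avoidVertex (M : ℕ) : Nat.card (AvoidVertex M) = 2 * M + 3 := by
  simp only [Nat.card_eq_fintype_card, Fintype.card_sum, Fintype.card_bool, Fintype.card_fin]
  omega

theorem avoid_hasPattern_root {M : ℕ} {X : Bool → Finset (Fin M)} {A : Finset (Fin M)} {b : Bool}
    (h : ¬ X b ⊆ A) : (avoid X).HasPattern A (.inl b) := by
  obtain ⟨j, hj, hjA⟩ := Finset.not_subset.1 h
  refine ⟨.inr (.inl j), fun p => .inr (.inr p), hj, (Fin.succ_ne_zero j).symm, fun i => ?_,
    fun a ha => ?_⟩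
  · simp [avoid, avoidAdj]
  · have : a ≠ j := fun e => hjA (e ▸ ha)
    simpa [avoid, avoidAdj] using this

/-- The pattern's walk has `M + 3` vertices, as many as there are levels, so it meets each level
once: a root, a guess, then the whole chain in order. -/
theorem exists_root_of_avoid_hasPattern {M : ℕ} {X : Bool → Finset (Fin M)} {A : Finset (Fin M)}
    {v : AvoidVertex M} (h : (avoid X).HasPattern A v) : ∃ b, v = .inl b ∧ ¬ X b ⊆ A := by
  obtain ⟨g, q, h1, h2, h3, h4⟩ := h
  have hv := avoidLevel_lt h1
  have hg := avoidLevel_lt h2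
  have hlow : ∀ j : Fin (M + 1), avoidLevel g + 1 + j.val ≤ avoidLevel (q j) := by
    intro j
    induction j using Fin.induction with
    | zero => simpa using hg
    | succ i ih =>
      have := avoidLevel_lt (h3 i)
      simp only [Fin.val_castSucc, Fin.val_succ] at *
      omega
  have hup : ∀ j : Fin (M + 1), avoidLevel (q j) + (M - j.val) ≤ M + 2 := by
    intro j
    induction j using Fin.reverseInduction with
    | last => simpa using avoidLevel_le (q (Fin.last M))
    | cast i ih =>
      have := avoidLevel_lt (h3 i)
      simp only [Fin.val_castSucc, Fin.val_succ] at *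
      omega
  have hq : ∀ j : Fin (M + 1), q j = .inr (.inr j) := by
    intro j
    have e1 := hlow j
    have e2 := hup j
    rcases hj : q j with b | k | p <;> rw [hj] at e1 e2 <;>
      simp only [avoidLevel_root, avoidLevel_guess, avoidLevel_position] at e1 e2
    · omega
    · omega
    · have : p = j := Fin.ext (by omega)
      rw [this]
  have e2 := hup 0
  have e1 := hlow 0
  simp only [Fin.val_zero] at e1 e2
  rcases g with b | j | p
  · simp only [avoidLevel_root] at hv
    omega
  · rcases v with b | k | p
    · refine ⟨b, rfl, fun hs => ?_⟩
      -- Guess `j` lacks only the arc to position `j + 1`, which the pattern would require.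
      have := h4 j (hs h1)
      rw [hq] at this
      exact this rfl
    · simp at hv
    · simp at hv
  · simp only [avoidLevel_position] at e1
    omega

theorem exists_isCoreOf {V : Type} [Finite V] (G : Digraph V) :
    ∃ (W : Type) (C : Digraph W), C.IsCoreOf G := by
  classical
  have hex : ∃ k : ℕ, ∃ (W : Type) (_ : Finite W) (C : Digraph W),
      C.HomEquiv G ∧ Nat.card W = k :=
    ⟨_, V, inferInstance, G, ⟨⟨RelHom.id _⟩, ⟨RelHom.id _⟩⟩, rfl⟩
  obtain ⟨W, hW, C, hC, hk⟩ := Nat.find_spec hex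
  exact ⟨W, C, hW, hC, fun U hU K hK => hk ▸ Nat.find_min' hex ⟨U, hU, K, hK, rfl⟩⟩

/-- Every digraph homomorphically equivalent to the product of the digraphs avoiding the members of
an antichain, grouped in pairs, distinguishes all tuples of roots. -/
theorem two_pow_card_le_of_homEquiv {ι W : Type} [Finite ι] [Finite W] {M : ℕ}
    {X : ι → Bool → Finset (Fin M)} (hX : ∀ i b i' b', X i b ⊆ X i' b' → i = i' ∧ b = b')
    {C : Digraph W} (h : C.HomEquiv (tensorProd fun i => avoid (X i))) :
    2 ^ Nat.card ι ≤ Nat.card W := by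
  obtain ⟨⟨f⟩, ⟨g⟩⟩ := h
  have key : ∀ S T : ι → Bool, ∀ i, S i = true → T i = false →
      g (fun j => .inl (S j)) ≠ g (fun j => .inl (T j)) := by
    intro S T i hS hT e
    have hpat : ∀ (R : ι → Bool) (b : Bool), R i ≠ b →
        (tensorProd fun i => avoid (X i)).HasPattern (X i b) (fun j => .inl (R j)) := by
      intro R b hb
      refine hasPattern_tensorProd.2 fun j => avoid_hasPattern_root fun hs => ?_
      obtain ⟨rfl, h2⟩ := hX _ _ _ _ hs
      exact hb h2
    -- If the images agree, coordinate `i` of the common round trip is a root having both patterns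
    -- `X i false` and `X i true`, yet root `b` lacks `X i b`.
    have hf := hasPattern_tensorProd.1 (((hpat S false (by simp [hS])).map g).map f) i
    have ht := hasPattern_tensorProd.1 (((hpat T true (by simp [hT])).map g).map f) i
    rw [← e] at ht
    obtain ⟨b, hb, hb1⟩ := exists_root_of_avoid_hasPattern hf
    obtain ⟨b', hb', hb2⟩ := exists_root_of_avoid_hasPattern ht
    obtain rfl : b = b' := Sum.inl_injective (hb.symm.trans hb')
    cases b
    · exact hb1 subset_rfl
    · exact hb2 subset_rfl
  have hinj : Function.Injective fun S : ι → Bool => g (fun j => .inl (S j)) := by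
    intro S T e
    funext i
    cases hS : S i <;> cases hT : T i
    · rfl
    · exact (key T S i hT hS e.symm).elim
    · exact (key S T i hS hT e).elim
    · rfl
  simpa [Nat.card_fun] using Nat.card_le_card_of_injective _ hinj

end Digraph

theorem Nat.two_pow_le_centralBinom (m : ℕ) : 2 ^ m ≤ m.centralBinom := by
  induction m with
  | zero => simp
  | succ m ih =>
    have h := Nat.succ_mul_centralBinom_succ m
    refine Nat.le_of_mul_le_mul_left (c := m + 1) ?_ m.succ_pos
    rw [h, pow_succ]
    nlinarith

/-- The middle layer is an antichain with at least `2 ^ (k + 1)` members. -/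
theorem exists_paired_antichain (k : ℕ) :
    ∃ X : Fin (2 ^ k) → Bool → Finset (Fin (2 * (k + 1))),
      ∀ i b i' b', X i b ⊆ X i' b' → i = i' ∧ b = b' := by
  obtain ⟨e⟩ : Nonempty (Fin (2 ^ k) × Bool ↪
      Finset.powersetCard (k + 1) (Finset.univ : Finset (Fin (2 * (k + 1))))) := by
    apply Function.Embedding.nonempty_of_card_le
    have := Nat.two_pow_le_centralBinom (k + 1)
    simpa [Nat.centralBinom, pow_succ] using this
  refine ⟨fun i b => (e (i, b)).1, fun i b i' b' h => ?_⟩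
  have hc : ∀ p, (e p).1.card = k + 1 := fun p => (Finset.mem_powersetCard.1 (e p).2).2
  have := e.injective (Subtype.ext (Finset.eq_of_subset_of_card_le h (by rw [hc, hc])))
  exact Prod.mk.inj this

theorem eventually_natCast_le_two_rpow_sqrt :
    ∀ᶠ n : ℕ in Filter.atTop, (n : ℝ) ≤ (2 : ℝ) ^ Real.sqrt (n : ℝ) := by
  have h := (isLittleO_log_rpow_atTop (r := 1 / 2) (by norm_num)).bound
    (Real.log_pos one_lt_two)
  filter_upwards [tendsto_natCast_atTop_atTop.eventually h, Filter.eventually_ge_atTop 1]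
    with n hn h1
  have hpos : (0 : ℝ) < n := by exact_mod_cast h1
  rw [← Real.sqrt_eq_rpow, Real.norm_of_nonneg (Real.sqrt_nonneg _)] at hn
  rw [← Real.log_le_log_iff hpos (by positivity), Real.log_rpow two_pos, mul_comm]
  exact (Real.le_norm_self _).trans hn

theorem rpow_two_rpow_sqrt_div_le {n : ℕ} (h0 : 0 < n)
    (h : (n : ℝ) ≤ (2 : ℝ) ^ Real.sqrt (n : ℝ)) :
    (n : ℝ) ^ ((2 : ℝ) ^ Real.sqrt (n : ℝ) / Real.sqrt (n : ℝ)) ≤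
      (2 : ℝ) ^ (2 ^ ⌈Real.sqrt (n : ℝ)⌉₊ : ℕ) := by
  have hs : 0 < Real.sqrt (n : ℝ) := Real.sqrt_pos.2 (by exact_mod_cast h0)
  calc (n : ℝ) ^ ((2 : ℝ) ^ Real.sqrt (n : ℝ) / Real.sqrt (n : ℝ))
      ≤ ((2 : ℝ) ^ Real.sqrt (n : ℝ)) ^ ((2 : ℝ) ^ Real.sqrt (n : ℝ) / Real.sqrt (n : ℝ)) :=
        Real.rpow_le_rpow (Nat.cast_nonneg n) h (by positivity)
    _ = (2 : ℝ) ^ ((2 : ℝ) ^ Real.sqrt (n : ℝ)) := by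
        rw [← Real.rpow_mul zero_le_two, mul_div_cancel₀ _ hs.ne']
    _ ≤ (2 : ℝ) ^ ((2 ^ ⌈Real.sqrt (n : ℝ)⌉₊ : ℕ) : ℝ) := by
        refine Real.rpow_le_rpow_of_exponent_le one_le_two ?_
        push_cast
        rw [← Real.rpow_natCast]
        exact Real.rpow_le_rpow_of_exponent_le one_le_two (Nat.le_ceil _)
    _ = _ := Real.rpow_natCast _ _

/-- The left side is the order `2 * M + 3` of a factor, for `M = 2 * (k + 1)` and `k = ⌈√n⌉`. -/
theorem four_mul_ceil_sqrt_add_seven_le {n : ℕ} (h : 49 ≤ n) :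
    4 * ⌈Real.sqrt (n : ℝ)⌉₊ + 7 ≤ n := by
  have hs : (7 : ℝ) ≤ Real.sqrt (n : ℝ) :=
    Real.le_sqrt_of_sq_le (by norm_num; exact_mod_cast h)
  have h1 := Nat.ceil_lt_add_one (Real.sqrt_nonneg (n : ℝ))
  have h2 := Real.sq_sqrt (Nat.cast_nonneg (α := ℝ) n)
  have : (4 * ⌈Real.sqrt (n : ℝ)⌉₊ + 7 : ℝ) ≤ n := by nlinarith
  exact_mod_cast this

theorem mainTheorem7 :
    ∃ c : ℝ, 0 < c ∧ ∀ᶠ n : ℕ in Filter.atTop,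
      ∃ (ι : Type) (_ : Finite ι) (_ : Nonempty ι)
        (V : ι → Type) (_ : ∀ i, Finite (V i)) (D : ∀ i, Digraph (V i)),
        (∀ i, (D i).IsLoopless) ∧
        (∀ i, Nat.card (V i) ≤ n) ∧
        ∃ (W : Type) (C : Digraph W), C.IsCoreOf (Digraph.tensorProd D) ∧
          c * (n : ℝ) ^ ((2 : ℝ) ^ Real.sqrt (n : ℝ) / Real.sqrt (n : ℝ)) ≤ (Nat.card W : ℝ) := by
  refine ⟨1, one_pos, ?_⟩
  filter_upwards [eventually_natCast_le_two_rpow_sqrt, Filter.eventually_ge_atTop 49] with n hn h49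
  obtain ⟨X, hX⟩ := exists_paired_antichain ⌈Real.sqrt (n : ℝ)⌉₊
  obtain ⟨W, C, hC⟩ := Digraph.exists_isCoreOf (Digraph.tensorProd fun i => Digraph.avoid (X i))
  refine ⟨_, inferInstance, ⟨⟨0, by positivity⟩⟩, _, fun _ => inferInstance,
    fun i => Digraph.avoid (X i), fun i => Digraph.avoid_isLoopless _, fun i => ?_, W, C, hC, ?_⟩
  · rw [Digraph.card_avoidVertex]
    have := four_mul_ceil_sqrt_add_seven_le h49
    omega
  · have := hC.1
    have hcard := Digraph.two_pow_card_le_of_homEquiv hX hC.2.1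
    rw [Nat.card_fin] at hcard
    rw [one_mul]
    exact (rpow_two_rpow_sqrt_div_le (by omega) hn).trans (by exact_mod_cast hcard)
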